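/- For a well quasi-order $A$, let $\mathrm{Bad}(A)$ be the tree (forest) of non-empty finite bad sequences of $A$, i.e. sequences $(x_1,\dots,x_k)$, $k\ge 1$, with $x_i\not\le x_j$ for all $i<j$, and let $\mathrm{Inco}(A)$ be the tree of non-empty finite sequences of pairwise incomparable elements of $A$ (antichains: $x_i\not\le x_j$ and $x_j\not\le x_i$ for $i<j$). Both are ordered by initial segment, the children of $s$ being its one-element extensions in the tree, and both are well-founded. The rank of a well-founded tree $T$ is $\sup_{s\in T}(r(s)+1)$, where $r(s)=\sup\{r(t)+1 : t \text{ a child of } s\}$ for each node $s$ (so $r(s)=0$ for a leaf). The width $w(A)$ is the rank of $\mathrm{Inco}(A)$ and the maximal order type $o(A)$ is the rank of $\mathrm{Bad}(A)$. Let $(\omega^\omega)^{\times n}$ denote the cartesian product of $n$ copies of the ordinal $\omega^\omega$, ordered componentwise. Then for every integer $n\ge 2$, $$w\bigl((\omega^\omega)^{\times n}\bigr)=\omega^{\omega\cdot n}=o\bigl((\omega^\omega)^{\times n}\bigr),$$ where $\omega^\omega$ and $\omega^{\omega\cdot n}$ are the usual ordinal exponentiation and product. -/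

import Mathlib

universe u

namespace WqoInvariants

variable {A : Type u}

/-- `t` is a child of `s` in the set of sequences `T` (ordered by initial segment):
`t` extends `s` by exactly one element. -/
def IsChild (T : Set (List A)) (t s : T) : Prop :=
  ∃ y : A, t.1 = s.1 ++ [y]

/-- The rank of a well-founded tree (or forest) `T` of finite sequences: the supremum of
`r s + 1` over the nodes `s`, where `r s` is the supremum of `r t + 1` over the children `t`
of `s`. -/
noncomputable def treeRank (T : Set (List A)) [IsWellFounded T (IsChild T)] : Ordinal.{u} :=
  ⨆ s : T, Order.succ (IsWellFounded.rank (IsChild T) s)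

/-- The non-empty finite bad sequences of `A`: no element is below a later one. -/
def Bad (A : Type u) [Preorder A] : Set (List A) :=
  {s | s ≠ [] ∧ s.Pairwise fun x y => ¬ x ≤ y}

/-- The non-empty finite antichains of `A`, as sequences of pairwise incomparable elements. -/
def Inco (A : Type u) [Preorder A] : Set (List A) :=
  {s | s ≠ [] ∧ s.Pairwise fun x y => ¬ x ≤ y ∧ ¬ y ≤ x}

theorem Inco_subset_Bad (A : Type u) [Preorder A] : Inco A ⊆ Bad A :=
  fun _ hs => ⟨hs.1, hs.2.imp fun h => h.1⟩

/-- In a well quasi-order, a set of bad sequences has no infinite branch. -/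
theorem isWellFounded_of_subset_Bad [Preorder A] [WellQuasiOrderedLE A] (T : Set (List A))
    (hT : T ⊆ Bad A) : IsWellFounded T (IsChild T) := by
  refine ⟨wellFounded_iff_isEmpty_descending_chain.2 ⟨?_⟩⟩
  rintro ⟨f, hf⟩
  choose y hy using hf
  have hmem : ∀ j i, i < j → y i ∈ (f j).1 := by
    intro j
    induction j with
    | zero => intro i hi; omega
    | succ j ih =>
      intro i hi
      rw [hy j]
      rcases Nat.lt_succ_iff_lt_or_eq.1 hi with h | rfl
      · exact List.mem_append_left _ (ih i h)
      · simp
  obtain ⟨i, j, hij, hle⟩ := wellQuasiOrdered_le y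
  have hp := (hT (f (j + 1)).2).2
  rw [hy j, List.pairwise_append] at hp
  exact hp.2.2 _ (hmem j i hij) _ (by simp) hle

instance isWellFounded_Bad (A : Type u) [Preorder A] [WellQuasiOrderedLE A] :
    IsWellFounded (Bad A) (IsChild (Bad A)) :=
  isWellFounded_of_subset_Bad _ subset_rfl

instance isWellFounded_Inco (A : Type u) [Preorder A] [WellQuasiOrderedLE A] :
    IsWellFounded (Inco A) (IsChild (Inco A)) :=
  isWellFounded_of_subset_Bad _ (Inco_subset_Bad A)

/-- The width of a well quasi-order: the rank of its tree of antichains. -/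
noncomputable def width (A : Type u) [Preorder A] [WellQuasiOrderedLE A] : Ordinal.{u} :=
  treeRank (Inco A)

/-- The maximal order type of a well quasi-order: the rank of its tree of bad sequences. -/
noncomputable def maxOrderType (A : Type u) [Preorder A] [WellQuasiOrderedLE A] : Ordinal.{u} :=
  treeRank (Bad A)

/-- The cartesian product `α^{×n}` of `n` copies of the ordinal `α` (regarded as a well-ordered
set), with the componentwise order. -/
abbrev OrdinalPower (α : Ordinal.{u}) (n : ℕ) : Type u := Fin n → α.ToType

end WqoInvariants

-- Since antichains are bad sequences, it suffices to bound the bad-sequence rank above and the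
-- antichain rank below by `ω ^ (ω * n)`. Both bounds are proved for boxes with sides `ω ^ e i`, `e
-- i ≤ ω`, by induction on the natural sum `totalExp e`.
--
-- Upper bound (`badRankLE_expBox`): after a first element `x`, every remaining `y` satisfies `y i <
-- x i` for some `i`. Each such slab is covered by finitely many boxes of smaller total exponent,
-- and ordinals below a power of `ω` are closed under natural sum.
--
-- Lower bound (`incoRankGE_box_mul_natCast`): stack `m` copies of a box along coordinate `i` and
-- play in the top copy first. Finitely many moves are bounded in another coordinate `j` of limit
-- length; moving past that bound in `j` leaves all lower copies usable, so the rank is multiplied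
-- by `m`. A coordinate of length `ω` serves as `j` while the others grow; then that coordinate
-- grows in turn with the help of another, which is where `n ≥ 2` enters. The exponent lost on it is
-- absorbed in the limit.

universe v w

namespace WqoInvariants

open Ordinal Function

/-! ### Rank bounds as recursive games on subsets -/

section Predicates

variable {A : Type v} {B : Type w} [Preorder A] [Preorder B]

/-- The tree of antichains of elements of `S` has rank at least `γ`. -/
def IncoRankGE (S : Set A) (γ : Ordinal.{u}) : Prop :=
  ∀ δ < γ, ∃ x ∈ S, IncoRankGE {y ∈ S | ¬ x ≤ y ∧ ¬ y ≤ x} δ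
termination_by γ

/-- The tree of bad sequences of elements of `S` has rank at most `γ`. -/
def BadRankLE (S : Set A) (γ : Ordinal.{u}) : Prop :=
  ∀ x ∈ S, ∃ δ, ∃ _ : δ < γ, BadRankLE {y ∈ S | ¬ x ≤ y} δ
termination_by γ

theorem IncoRankGE.mono {S T : Set A} {γ : Ordinal.{u}} (hST : S ⊆ T) (h : IncoRankGE S γ) :
    IncoRankGE T γ := by
  induction γ using WellFoundedLT.induction generalizing S T with
  | ind γ ih =>
    rw [IncoRankGE] at h ⊢
    intro δ hδ
    obtain ⟨x, hx, hW⟩ := h δ hδ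
    exact ⟨x, hST hx, ih δ hδ (fun y hy => ⟨hST hy.1, hy.2⟩) hW⟩

theorem IncoRankGE.comap {g : B → A} (hg : Monotone g) {γ : Ordinal.{u}} :
    ∀ {S : Set A}, S ⊆ Set.range g → IncoRankGE S γ → IncoRankGE (g ⁻¹' S) γ := by
  induction γ using WellFoundedLT.induction with
  | ind γ ih =>
    intro S hS h
    rw [IncoRankGE] at h ⊢
    intro δ hδ
    obtain ⟨x, hx, hxW⟩ := h δ hδ
    obtain ⟨p, rfl⟩ := hS hx
    refine ⟨p, hx, ?_⟩
    refine (ih δ hδ (fun y hy => hS hy.1) hxW).mono ?_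
    intro q hq
    exact ⟨hq.1, fun h => hq.2.1 (hg h), fun h => hq.2.2 (hg h)⟩

theorem IncoRankGE.of_forall_lt {S : Set A} {γ : Ordinal.{u}}
    (h : ∀ δ < γ, ∃ ε > δ, IncoRankGE S ε) : IncoRankGE S γ := by
  rw [IncoRankGE]
  intro δ hδ
  obtain ⟨ε, hε, hS⟩ := h δ hδ
  rw [IncoRankGE] at hS
  exact hS δ hε

theorem incoRankGE_one {S : Set A} (hS : S.Nonempty) : IncoRankGE S (1 : Ordinal.{u}) := by
  rw [IncoRankGE]
  intro δ hδ
  obtain ⟨x, hx⟩ := hS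
  obtain rfl := Order.lt_one_iff.1 hδ
  refine ⟨x, hx, ?_⟩
  rw [IncoRankGE]
  intro ε hε
  exact absurd hε (not_lt_bot)

/-- If one can play in `T` first and any finite part of `T` leaves rank `δ` in `S ⊇ T`,
the ranks add up. -/
theorem IncoRankGE.add {γ δ : Ordinal.{u}} {S T : Set A} (hTS : T ⊆ S) (hT : IncoRankGE T γ)
    (hS : ∀ Y : Set A, Y.Finite → Y ⊆ T →
      IncoRankGE {x ∈ S | ∀ y ∈ Y, ¬ y ≤ x ∧ ¬ x ≤ y} δ) :
    IncoRankGE S (δ + γ) := by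
  induction γ using WellFoundedLT.induction generalizing S T with
  | ind γ ih =>
    have h0 : IncoRankGE S δ := (hS ∅ Set.finite_empty (Set.empty_subset _)).mono fun x hx => hx.1
    rw [IncoRankGE]
    intro ε hε
    rcases lt_or_ge ε δ with h | h
    · rw [IncoRankGE] at h0
      exact h0 ε h
    · obtain ⟨ε, rfl⟩ := exists_add_of_le h
      have hε' : ε < γ := by simpa using hε
      rw [IncoRankGE] at hT
      obtain ⟨x, hx, hW⟩ := hT ε hε'
      refine ⟨x, hTS hx, ih ε hε' (fun y hy => ⟨hTS hy.1, hy.2⟩) hW ?_⟩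
      intro Y hY hYT
      -- The move `x` joins the finite part already played in `T`.
      refine (hS (insert x Y) (hY.insert x)
        (Set.insert_subset hx fun y hy => (hYT hy).1)).mono ?_
      rintro z ⟨hz, h⟩
      exact ⟨⟨hz, h x (Set.mem_insert _ _)⟩, fun y hy => h y (Set.mem_insert_of_mem _ hy)⟩

theorem BadRankLE.mono {S T : Set A} {γ : Ordinal.{u}} (hST : S ⊆ T) (h : BadRankLE T γ) :
    BadRankLE S γ := by
  induction γ using WellFoundedLT.induction generalizing S T with
  | ind γ ih =>
    rw [BadRankLE] at h ⊢
    intro x hx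
    obtain ⟨δ, hδ, hU⟩ := h x (hST hx)
    refine ⟨δ, hδ, ih δ hδ ?_ hU⟩
    exact fun y hy => ⟨hST hy.1, hy.2⟩

theorem BadRankLE.comap {g : B → A} (hg : ∀ x y, g x ≤ g y → x ≤ y) {S : Set A}
    {γ : Ordinal.{u}} (h : BadRankLE S γ) : BadRankLE (g ⁻¹' S) γ := by
  induction γ using WellFoundedLT.induction generalizing S with
  | ind γ ih =>
    rw [BadRankLE] at h ⊢
    intro p hp
    obtain ⟨δ, hδ, hU⟩ := h (g p) hp
    refine ⟨δ, hδ, (ih δ hδ hU).mono ?_⟩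
    exact fun q hq => ⟨hq.1, fun h => hq.2 (hg _ _ h)⟩

theorem badRankLE_empty {γ : Ordinal.{u}} : BadRankLE (∅ : Set A) γ := by
  rw [BadRankLE]
  exact fun x hx => absurd hx (Set.notMem_empty x)

end Predicates

/-! ### From rank bounds to ranks of trees -/

section TreeRank

variable {A : Type u} [Preorder A]

theorem le_rank_of_incoRankGE {T : Set (List A)} [IsWellFounded T (IsChild T)]
    (hT : Inco A ⊆ T) {γ : Ordinal.{u}} {s : T} (hs : s.1 ∈ Inco A)
    (h : IncoRankGE {y : A | ∀ x ∈ s.1, ¬ x ≤ y ∧ ¬ y ≤ x} γ) :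
    γ ≤ IsWellFounded.rank (IsChild T) s := by
  induction γ using WellFoundedLT.induction generalizing s with
  | ind γ ih =>
    refine le_of_forall_lt fun δ hδ => ?_
    rw [IncoRankGE] at h
    obtain ⟨x, hx, hW⟩ := h δ hδ
    have hmem : s.1 ++ [x] ∈ Inco A := by
      refine ⟨by simp, List.pairwise_append.2 ⟨hs.2, by simp, ?_⟩⟩
      intro a ha b hb
      obtain rfl := List.mem_singleton.1 hb
      exact hx a ha
    have hchild : IsChild T ⟨s.1 ++ [x], hT hmem⟩ s := ⟨x, rfl⟩
    refine (ih δ hδ (s := ⟨s.1 ++ [x], hT hmem⟩) hmem (hW.mono ?_)).trans_lt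
      (IsWellFounded.rank_lt_of_rel hchild)
    rintro y ⟨hy, hxy⟩ a ha
    rcases List.mem_append.1 ha with h | h
    · exact hy a h
    · obtain rfl := List.mem_singleton.1 h
      exact hxy

theorem le_treeRank {T : Set (List A)} [IsWellFounded T (IsChild T)]
    (hT : Inco A ⊆ T) {γ : Ordinal.{u}} (h : IncoRankGE (Set.univ : Set A) γ) :
    γ ≤ treeRank T := by
  refine le_of_forall_lt fun δ hδ => ?_
  rw [IncoRankGE] at h
  obtain ⟨x, -, hW⟩ := h δ hδ
  have hmem : [x] ∈ Inco A := ⟨by simp, by simp⟩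
  have := le_rank_of_incoRankGE hT (s := ⟨[x], hT hmem⟩) hmem
    (hW.mono fun y hy a ha => by
      obtain rfl := List.mem_singleton.1 ha
      exact hy.2)
  exact (Order.lt_succ_of_le this).trans_le
    (le_ciSup (f := fun s : T => Order.succ (IsWellFounded.rank (IsChild T) s))
      Ordinal.bddAbove_of_small _)

theorem rank_le_of_badRankLE {T : Set (List A)} [IsWellFounded T (IsChild T)]
    (hT : T ⊆ Bad A) {γ : Ordinal.{u}} {s : T}
    (h : BadRankLE {y : A | ∀ x ∈ s.1, ¬ x ≤ y} γ) :
    IsWellFounded.rank (IsChild T) s ≤ γ := by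
  induction γ using WellFoundedLT.induction generalizing s with
  | ind γ ih =>
    rw [IsWellFounded.rank_eq]
    refine ciSup_le' ?_
    rintro ⟨t, x, hx⟩
    rw [Order.succ_le_iff]
    have hp := (hT t.2).2
    rw [hx, List.pairwise_append] at hp
    rw [BadRankLE] at h
    obtain ⟨δ, hδ, hU⟩ := h x fun a ha => hp.2.2 a ha x (by simp)
    refine (ih δ hδ (s := t) (hU.mono ?_)).trans_lt hδ
    intro y hy
    rw [Set.mem_ofPred_eq, hx] at hy
    exact ⟨fun a ha => hy a (by simp [ha]), hy x (by simp)⟩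

theorem treeRank_le {T : Set (List A)} [IsWellFounded T (IsChild T)]
    (hT : T ⊆ Bad A) {γ : Ordinal.{u}} (h : BadRankLE (Set.univ : Set A) γ) :
    treeRank T ≤ γ := by
  refine ciSup_le' fun s => ?_
  rw [Order.succ_le_iff]
  -- Nodes are non-empty, so some element of `s` can be charged as a first move; this makes the
  -- bound on the rank of `s` strict.
  obtain ⟨x, hx⟩ := List.exists_mem_of_ne_nil _ (hT s.2).1
  rw [BadRankLE] at h
  obtain ⟨δ, hδ, hU⟩ := h x trivial
  refine (rank_le_of_badRankLE hT (hU.mono ?_)).trans_lt hδ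
  exact fun y hy => ⟨trivial, hy x hx⟩

end TreeRank

/-! ### Natural sums and finite unions -/

section NaturalSum

/-- The natural (Hessenberg) sum of two ordinals. -/
noncomputable def natSum (a b : Ordinal.{u}) : Ordinal.{u} :=
  max (⨆ x : Set.Iio a, Order.succ (natSum x.1 b)) (⨆ x : Set.Iio b, Order.succ (natSum a x.1))
termination_by (a, b)
decreasing_by
  · exact Prod.Lex.left _ _ x.2
  · exact Prod.Lex.right _ x.2

theorem natSum_lt_left {a a' : Ordinal.{u}} (h : a' < a) (b : Ordinal.{u}) :
    natSum a' b < natSum a b := by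
  rw [natSum.eq_def a b]
  refine lt_max_of_lt_left (Order.succ_le_iff.1 ?_)
  exact le_ciSup (f := fun x : Set.Iio a => Order.succ (natSum x.1 b))
    Ordinal.bddAbove_of_small ⟨a', h⟩

theorem natSum_lt_right (a : Ordinal.{u}) {b b' : Ordinal.{u}} (h : b' < b) :
    natSum a b' < natSum a b := by
  rw [natSum.eq_def a b]
  refine lt_max_of_lt_right (Order.succ_le_iff.1 ?_)
  exact le_ciSup (f := fun x : Set.Iio b => Order.succ (natSum a x.1))
    Ordinal.bddAbove_of_small ⟨b', h⟩

theorem natSum_le {a b c : Ordinal.{u}} (h₁ : ∀ a' < a, natSum a' b < c)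
    (h₂ : ∀ b' < b, natSum a b' < c) : natSum a b ≤ c := by
  rw [natSum]
  exact max_le (ciSup_le' fun x => Order.succ_le_iff.2 (h₁ _ x.2))
    (ciSup_le' fun x => Order.succ_le_iff.2 (h₂ _ x.2))

/-- Lowering an argument lowers either its quotient by `P`, and then closure of `P` makes the new
remainder harmless, or its remainder with the quotient fixed. -/
theorem natSum_mul_add_le {P : Ordinal.{u}} (hP : ∀ a < P, ∀ b < P, natSum a b < P)
    (a b : Ordinal.{u}) : ∀ (m k : ℕ), ∀ r < P, ∀ s < P, a = P * m + r → b = P * k + s →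
      natSum a b ≤ P * (m + k : ℕ) + natSum r s := by
  have split : ∀ {c : Ordinal.{u}} {m : ℕ} {r : Ordinal.{u}}, r < P → c < P * m + r →
      ∃ q : ℕ, ∃ t < P, c = P * q + t ∧ (q < m ∨ q = m ∧ t < r) := by
    intro c m r hr hc
    have hP0 : P ≠ 0 := (bot_le.trans_lt hr).ne'
    have hq : c / P < (m : Ordinal.{u}) + 1 := by
      rw [← Ordinal.lt_mul_iff_div_lt hP0, mul_add, mul_one]
      exact hc.trans (by gcongr)
    obtain ⟨q, hq'⟩ := Ordinal.lt_omega0.1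
      (hq.trans (by exact_mod_cast Ordinal.natCast_lt_omega0 (m + 1)))
    have hqm : q ≤ m := by
      rw [hq'] at hq
      have : q < m + 1 := by exact_mod_cast hq
      omega
    have hc' : c = P * q + c % P := by rw [← hq', Ordinal.div_add_mod]
    refine ⟨q, c % P, Ordinal.mod_lt _ hP0, hc', ?_⟩
    rcases hqm.lt_or_eq with h | rfl
    · exact Or.inl h
    · refine Or.inr ⟨rfl, ?_⟩
      rw [hc'] at hc
      simpa using hc
  have small : ∀ {q m : ℕ} {t c : Ordinal.{u}}, t < P → q < m →
      P * (q : ℕ) + t < P * (m : ℕ) + c := by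
    intro q m t c ht hq
    calc P * (q : ℕ) + t < P * (q : ℕ) + P := by gcongr
      _ = P * (q + 1 : ℕ) := by push_cast; rw [mul_add, mul_one]
      _ ≤ P * (m : ℕ) := by gcongr; omega
      _ ≤ _ := le_self_add
  induction a using WellFoundedLT.induction generalizing b with
  | ind a iha =>
  induction b using WellFoundedLT.induction with
  | ind b ihb =>
    intro m k r hr s hs ha hb
    refine natSum_le (fun a' ha' => ?_) (fun b' hb' => ?_)
    · obtain ⟨q, t, ht, hat, h⟩ := split hr (ha ▸ ha')
      refine (iha a' ha' b q k t ht s hs hat hb).trans_lt ?_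
      rcases h with h | ⟨rfl, h⟩
      · exact small (hP t ht s hs) (by omega)
      · have := natSum_lt_left h s
        gcongr
    · obtain ⟨q, t, ht, hbt, h⟩ := split hs (hb ▸ hb')
      refine (ihb b' hb' m q r hr t ht ha hbt).trans_lt ?_
      rcases h with h | ⟨rfl, h⟩
      · exact small (hP r hr t ht) (by omega)
      · have := natSum_lt_right r h
        gcongr

theorem natSum_lt_omega0_opow (e : Ordinal.{u}) :
    ∀ a < ω ^ e, ∀ b < ω ^ e, natSum a b < ω ^ e := by
  induction e using Ordinal.limitRecOn with
  | zero =>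
    intro a ha b hb
    simp only [opow_zero, Order.lt_one_iff] at ha hb ⊢
    subst ha hb
    exact le_antisymm (natSum_le (fun c hc => absurd hc not_lt_bot)
      fun c hc => absurd hc not_lt_bot) bot_le
  | add_one e ih =>
    have hpos : ω ^ e ≠ (0 : Ordinal.{u}) := (opow_pos e omega0_pos).ne'
    have split : ∀ {c : Ordinal.{u}}, c < ω ^ (e + 1) →
        ∃ q : ℕ, ∃ r < ω ^ e, c = ω ^ e * q + r := by
      intro c hc
      rw [opow_add_one, Ordinal.lt_mul_iff_div_lt hpos] at hc
      obtain ⟨q, hq⟩ := Ordinal.lt_omega0.1 hc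
      exact ⟨q, c % ω ^ e, Ordinal.mod_lt _ hpos, by rw [← hq, Ordinal.div_add_mod]⟩
    intro a ha b hb
    obtain ⟨m, r, hr, rfl⟩ := split ha
    obtain ⟨k, s, hs, rfl⟩ := split hb
    refine (natSum_mul_add_le ih _ _ m k r hr s hs rfl rfl).trans_lt ?_
    exact opow_mul_add_lt_opow (natCast_lt_omega0 _) (ih r hr s hs) (lt_add_one e)
  | limit e he ih =>
    intro a ha b hb
    obtain ⟨c, hc, ha⟩ := (lt_opow_of_isSuccLimit omega0_ne_zero he).1 ha
    obtain ⟨d, hd, hb⟩ := (lt_opow_of_isSuccLimit omega0_ne_zero he).1 hb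
    have hmax : max c d < e := max_lt hc hd
    refine (ih _ hmax a (ha.trans_le ?_) b (hb.trans_le ?_)).trans
      ((opow_lt_opow_iff_right one_lt_omega0).2 hmax)
    · exact opow_le_opow_right omega0_pos (le_max_left _ _)
    · exact opow_le_opow_right omega0_pos (le_max_right _ _)

variable {A : Type v} [Preorder A]

/-- Each move lies in `S` or in `T` and lowers the corresponding argument of the natural sum. -/
theorem BadRankLE.union {S T : Set A} {γ δ : Ordinal.{u}} (hS : BadRankLE S γ)
    (hT : BadRankLE T δ) : BadRankLE (S ∪ T) (natSum γ δ) := by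
  induction γ using WellFoundedLT.induction generalizing S T δ with
  | ind γ ihγ =>
  induction δ using WellFoundedLT.induction generalizing S T with
  | ind δ ihδ =>
    have hS' := hS
    have hT' := hT
    rw [BadRankLE] at hS' hT' ⊢
    rintro x (hx | hx)
    · obtain ⟨ε, hε, hU⟩ := hS' x hx
      refine ⟨_, natSum_lt_left hε δ, (ihγ ε hε hU hT).mono ?_⟩
      rintro y ⟨hy | hy, hxy⟩
      exacts [Or.inl ⟨hy, hxy⟩, Or.inr hy]
    · obtain ⟨ε, hε, hU⟩ := hT' x hx
      refine ⟨_, natSum_lt_right γ hε, (ihδ ε hε hS hU).mono ?_⟩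
      rintro y ⟨hy | hy, hxy⟩
      exacts [Or.inl hy, Or.inr ⟨hy, hxy⟩]

theorem exists_badRankLE_iUnion {ι : Type*} (s : Finset ι) (S : ι → Set A) (e : Ordinal.{u})
    (h : ∀ i ∈ s, ∃ γ < ω ^ e, BadRankLE (S i) γ) :
    ∃ γ < ω ^ e, BadRankLE (⋃ i ∈ s, S i) γ := by
  classical
  induction s using Finset.induction_on with
  | empty => exact ⟨0, opow_pos e omega0_pos, by simpa using badRankLE_empty⟩
  | insert i s _ ih =>
    obtain ⟨γ, hγ, hU⟩ := ih fun j hj => h j (Finset.mem_insert_of_mem hj)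
    obtain ⟨δ, hδ, hV⟩ := h i (Finset.mem_insert_self _ _)
    refine ⟨natSum δ γ, natSum_lt_omega0_opow e δ hδ γ hγ, ?_⟩
    rw [Finset.set_biUnion_insert]
    exact hV.union hU

end NaturalSum

/-! ### Exponents up to `ω` and their natural sum -/

section Exponents

/-- The ordinal `ω` or `k` denoted by an extended natural number. -/
noncomputable def toExp (a : ℕ∞) : Ordinal.{u} := if a = ⊤ then ω else (a.toNat : Ordinal.{u})

@[simp] theorem toExp_top : toExp ⊤ = ω := by simp [toExp]

@[simp] theorem toExp_natCast (k : ℕ) : toExp (k : ℕ∞) = k := by simp [toExp]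

theorem toExp_mono : Monotone toExp.{u} := by
  intro a b h
  induction b using ENat.recTopCoe with
  | top =>
    induction a using ENat.recTopCoe with
    | top => exact le_rfl
    | coe a => simpa using (natCast_lt_omega0 a).le
  | coe b =>
    lift a to ℕ using ne_top_of_le_ne_top (ENat.natCast_ne_top b) h
    simpa using h

theorem toExp_ne_zero {a : ℕ∞} (ha : a ≠ 0) : toExp.{u} a ≠ 0 := by
  induction a using ENat.recTopCoe with
  | top => simp
  | coe a => simpa using ha

theorem exists_lt_opow_mul {a : ℕ∞} (ha : a ≠ 0) {d : Ordinal.{u}} (hd : d < ω ^ toExp a) :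
    ∃ k m : ℕ, (k : ℕ∞) < a ∧ d < ω ^ (k : Ordinal.{u}) * m := by
  have key : ∀ k : ℕ, d < ω ^ ((k : Ordinal.{u}) + 1) →
      ∃ m : ℕ, d < ω ^ (k : Ordinal.{u}) * m := by
    intro k hk
    rw [opow_add_one, lt_mul_iff_of_isSuccLimit isSuccLimit_omega0] at hk
    obtain ⟨c, hc, h⟩ := hk
    obtain ⟨m, rfl⟩ := lt_omega0.1 hc
    exact ⟨m, h⟩
  induction a using ENat.recTopCoe with
  | top =>
    rw [toExp_top, lt_opow_of_isSuccLimit omega0_ne_zero isSuccLimit_omega0] at hd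
    obtain ⟨c, hc, h⟩ := hd
    obtain ⟨k, rfl⟩ := lt_omega0.1 hc
    obtain ⟨m, hm⟩ := key k (h.trans_le (opow_le_opow_right omega0_pos le_self_add))
    exact ⟨k, m, ENat.natCast_lt_top k, hm⟩
  | coe a =>
    obtain ⟨k, rfl⟩ := Nat.exists_eq_succ_of_ne_zero (by simpa using ha : a ≠ 0)
    obtain ⟨m, hm⟩ := key k (by rwa [toExp_natCast, Nat.cast_succ] at hd)
    exact ⟨k, m, by exact_mod_cast Nat.lt_succ_self k, hm⟩

theorem exists_lt_opow_add_natCast {a d : Ordinal.{u}} (hd : d < ω ^ (a + ω)) :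
    ∃ k : ℕ, d < ω ^ (a + k) := by
  obtain ⟨c, hc, h⟩ := (lt_opow_of_isSuccLimit omega0_ne_zero
    (isSuccLimit_add a isSuccLimit_omega0)).1 hd
  obtain ⟨l, hl, hcl⟩ := (lt_add_iff_of_isSuccLimit isSuccLimit_omega0).1 hc
  obtain ⟨k, rfl⟩ := lt_omega0.1 hl
  exact ⟨k, h.trans_le (opow_le_opow_right omega0_pos hcl.le)⟩

variable {n : ℕ}

/-- The natural sum of a family of exponents at most `ω`. -/
noncomputable def totalExp (e : Fin n → ℕ∞) : Ordinal.{u} :=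
  ω * (∑ i, if e i = ⊤ then 1 else 0 : ℕ) + (∑ i, (e i).toNat : ℕ)

/-- Isolates the contribution of coordinate `i`, with `c` and `s` independent of the new value.
Since `⊤` has `toNat` zero, infinite exponents count only in `c`. -/
theorem exists_totalExp_update (e : Fin n → ℕ∞) (i : Fin n) :
    ∃ c s : ℕ, s + (e i).toNat = ∑ j, (e j).toNat ∧ ∀ a : ℕ∞, totalExp.{u} (update e i a) =
      ω * (c + if a = ⊤ then 1 else 0 : ℕ) + (s + a.toNat : ℕ) := by
  refine ⟨∑ j ∈ Finset.univ.erase i, if e j = ⊤ then 1 else 0,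
    ∑ j ∈ Finset.univ.erase i, (e j).toNat,
    Finset.sum_erase_add _ _ (Finset.mem_univ i), fun a => ?_⟩
  rw [totalExp, ← Finset.sum_erase_add _ _ (Finset.mem_univ i),
    ← Finset.sum_erase_add _ (fun j => (update e i a j).toNat) (Finset.mem_univ i)]
  have hne : ∀ j ∈ Finset.univ.erase i, update e i a j = e j := fun j hj =>
    update_of_ne (Finset.ne_of_mem_erase hj) _ _
  rw [Finset.sum_congr rfl fun j hj => by rw [hne j hj],
    Finset.sum_congr (s₁ := Finset.univ.erase i) (f := fun j => (update e i a j).toNat) rfl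
      fun j hj => by rw [hne j hj]]
  simp only [update_self]

theorem totalExp_update_lt {e : Fin n → ℕ∞} {i : Fin n} {k : ℕ} (h : (k : ℕ∞) < e i) :
    totalExp.{u} (update e i k) < totalExp e := by
  obtain ⟨c, s, -, H⟩ := exists_totalExp_update.{u} e i
  have he := H (e i)
  rw [update_eq_self] at he
  rw [he, H]
  generalize e i = a at *
  induction a using ENat.recTopCoe with
  | top =>
    simp only [ENat.natCast_ne_top, if_false, if_true, ENat.toNat_natCast, ENat.toNat_top, add_zero]
    push_cast
    rw [mul_add, mul_one, add_assoc]
    refine add_lt_add_right ?_ _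
    exact lt_of_lt_of_le (by exact_mod_cast natCast_lt_omega0 (s + k)) le_self_add
  | coe a =>
    simp only [ENat.natCast_ne_top, if_false, ENat.toNat_natCast]
    have : k < a := by exact_mod_cast h
    refine add_lt_add_right ?_ _
    exact_mod_cast Nat.add_lt_add_left this s

end Exponents

/-! ### Upper bound: bad sequences in boxes -/

section Boxes

variable {n : ℕ}

/-- The box of tuples of ordinals with lowest corner `b` and side lengths `l`. -/
def box (b l : Fin n → Ordinal.{u}) : Set (Fin n → Ordinal.{u}) :=
  {f | ∀ i, b i ≤ f i ∧ f i < b i + l i}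

/-- The box with lowest corner `b` and side lengths `ω ^ e i`. -/
def expBox (b : Fin n → Ordinal.{u}) (e : Fin n → ℕ∞) : Set (Fin n → Ordinal.{u}) :=
  box b fun i => ω ^ toExp (e i)

theorem expBox_mono (b : Fin n → Ordinal.{u}) {e e' : Fin n → ℕ∞} (h : e ≤ e') :
    expBox b e ⊆ expBox b e' := fun _ hf i =>
  ⟨(hf i).1, (hf i).2.trans_le
    (add_le_add_right (opow_le_opow_right omega0_pos (toExp_mono (h i))) _)⟩

/-- The slab has height less than `ω ^ k * m` for some `k < e i`, so `m` boxes of side `ω ^ k` in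
direction `i` cover it. -/
theorem exists_badRankLE_slab {e : Fin n → ℕ∞} {b x : Fin n → Ordinal.{u}}
    (hx : x ∈ expBox b e) (i : Fin n)
    (ih : ∀ k : ℕ, (k : ℕ∞) < e i → ∀ b' : Fin n → Ordinal.{u},
      BadRankLE (expBox b' (update e i k)) (ω ^ totalExp.{u} (update e i k))) :
    ∃ γ < ω ^ totalExp.{u} e, BadRankLE {y ∈ expBox b e | y i < x i} γ := by
  obtain ⟨d, hd⟩ := exists_add_of_le (hx i).1
  have hdl : d < ω ^ toExp (e i) := by
    have := (hx i).2
    rw [hd] at this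
    simpa using this
  by_cases he : e i = 0
  · refine ⟨0, opow_pos _ omega0_pos, badRankLE_empty.mono ?_⟩
    rintro y ⟨hy, hyx⟩
    have hd0 : d = 0 := by
      have h0 : toExp.{u} 0 = 0 := by simpa using toExp_natCast 0
      simpa [he, h0] using hdl
    rw [hd, hd0, add_zero] at hyx
    exact absurd (hy i).1 hyx.not_ge
  · obtain ⟨k, m, hk, hdm⟩ := exists_lt_opow_mul he hdl
    obtain ⟨γ, hγ, hU⟩ := exists_badRankLE_iUnion (Finset.range m)
      (fun j => expBox (update b i (b i + ω ^ (k : Ordinal.{u}) * j)) (update e i k))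
      (totalExp.{u} e) fun j _ => ⟨_, (opow_lt_opow_iff_right one_lt_omega0).2
        (totalExp_update_lt hk), ih k hk _⟩
    refine ⟨γ, hγ, hU.mono ?_⟩
    rintro y ⟨hy, hyx⟩
    obtain ⟨t, ht⟩ := exists_add_of_le (hy i).1
    have htm : t < ω ^ (k : Ordinal.{u}) * m := by
      rw [ht, hd] at hyx
      exact (by simpa using hyx : t < d).trans hdm
    -- The quotient of the height of `y` by `ω ^ k` is the index of the box containing `y`.
    obtain ⟨q, hq, r, hr, rfl⟩ := lt_mul_iff.1 htm
    obtain ⟨q, rfl⟩ := lt_omega0.1 (hq.trans (natCast_lt_omega0 m))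
    refine Set.mem_biUnion (x := q) (by simpa using hq) fun j => ?_
    rcases eq_or_ne j i with rfl | hj
    · simp only [update_self, toExp_natCast]
      rw [ht, ← add_assoc]
      exact ⟨le_self_add, by gcongr⟩
    · simpa only [update_of_ne hj] using hy j

theorem badRankLE_expBox (e : Fin n → ℕ∞) (b : Fin n → Ordinal.{u}) :
    BadRankLE (expBox b e) (ω ^ totalExp.{u} e) := by
  induction h : totalExp.{u} e using WellFoundedLT.induction generalizing e b with
  | ind E ih =>
    subst h
    rw [BadRankLE]
    intro x hx
    obtain ⟨γ, hγ, hU⟩ := exists_badRankLE_iUnion Finset.univ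
      (fun i => {y ∈ expBox b e | y i < x i}) (totalExp.{u} e) fun i _ =>
        exists_badRankLE_slab hx i fun k hk b' => ih _ (totalExp_update_lt hk) _ b' rfl
    refine ⟨γ, hγ, hU.mono ?_⟩
    rintro y ⟨hy, hxy⟩
    simp only [Pi.le_def, not_forall, not_le] at hxy
    obtain ⟨i, hi⟩ := hxy
    exact Set.mem_biUnion (Finset.mem_coe.2 (Finset.mem_univ i)) ⟨hy, hi⟩

/-! ### Lower bound: antichains in boxes -/

theorem exists_lt_of_finite {ι : Type*} {Y : Set ι} (hY : Y.Finite) {f : ι → Ordinal.{u}}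
    {a l : Ordinal.{u}} (hl : Order.IsSuccLimit l) (h : ∀ y ∈ Y, f y < a + l) :
    ∃ d < l, ∀ y ∈ Y, f y < a + d := by
  induction Y, hY using Set.Finite.induction_on with
  | empty => exact ⟨0, hl.bot_lt, fun y hy => absurd hy (Set.notMem_empty y)⟩
  | @insert y Y _ _ ih =>
    obtain ⟨d, hd, H⟩ := ih fun y hy => h y (Set.mem_insert_of_mem _ hy)
    obtain ⟨c, hc, hy⟩ := (lt_add_iff_of_isSuccLimit hl).1 (h y (Set.mem_insert _ _))
    refine ⟨max c d, max_lt hc hd, ?_⟩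
    rintro z (rfl | hz)
    · exact hy.trans_le (add_le_add_right (le_max_left _ _) _)
    · exact (H z hz).trans_le (add_le_add_right (le_max_right _ _) _)

theorem incoRankGE_box_mul_natCast {l : Fin n → Ordinal.{u}} {i j : Fin n} (hij : j ≠ i)
    {c : Ordinal.{u}} (hc : c ≠ 0) (hj : l j = ω ^ c) {γ : Ordinal.{u}}
    (h : ∀ b : Fin n → Ordinal.{u}, IncoRankGE (box b l) γ) (m : ℕ)
    (b : Fin n → Ordinal.{u}) : IncoRankGE (box b (update l i (l i * m))) (γ * m) := by
  induction m generalizing b with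
  | zero =>
    rw [IncoRankGE]
    intro δ hδ
    simp at hδ
  | succ m ih =>
    push_cast
    rw [show γ * ((m : Ordinal.{u}) + 1) = γ * m + γ by rw [mul_add, mul_one]]
    -- `T` is the topmost of the `m + 1` copies.
    refine IncoRankGE.add (T := box (update b i (b i + l i * m)) l) ?_ (h _) ?_
    · intro f hf t
      have := hf t
      rcases eq_or_ne t i with rfl | ht
      · simp only [update_self] at this ⊢
        exact ⟨le_self_add.trans this.1, by rw [mul_add, mul_one, ← add_assoc]; exact this.2⟩
      · simpa only [update_of_ne ht] using this
    · intro Y hY hYT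
      obtain ⟨d, hd, H⟩ := exists_lt_of_finite hY (f := fun y => y j) (a := b j) (l := ω ^ c)
        (isSuccLimit_opow_left isSuccLimit_omega0 hc) fun y hy => by
          have := (hYT hy j).2
          rwa [update_of_ne hij, hj] at this
      refine (ih (update b j (b j + d))).mono fun f hf => ⟨fun t => ?_, fun y hy => ?_⟩
      · have := hf t
        rcases eq_or_ne t i with rfl | ht
        · simp only [update_self, update_of_ne hij.symm] at this ⊢
          exact ⟨this.1, this.2.trans_le (by gcongr; exact le_self_add)⟩
        · simp only [update_of_ne ht] at this ⊢
          rcases eq_or_ne t j with rfl | htj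
          · rw [update_self, hj, add_assoc, add_omega0_opow hd] at this
            rw [hj]
            exact ⟨le_self_add.trans this.1, this.2⟩
          · simpa only [update_of_ne htj] using this
      · have hi := (hf i).2
        have hyi := (hYT hy i).1
        simp only [update_self, update_of_ne hij.symm] at hi hyi
        have hfj := (hf j).1
        rw [update_self] at hfj
        -- New points are below `Y` in coordinate `i` and above it in coordinate `j`.
        exact ⟨fun hle => ((hle i).trans_lt hi).not_ge hyi,
          fun hle => ((H y hy).trans_le (hfj.trans (hle j))).false⟩

theorem incoRankGE_expBox_add_one {e : Fin n → ℕ∞} {i j : Fin n} (hij : j ≠ i) (hj : e j ≠ 0)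
    {k : ℕ} {γ : Ordinal.{u}}
    (h : ∀ b : Fin n → Ordinal.{u}, IncoRankGE (expBox b (update e i k)) γ)
    (b : Fin n → Ordinal.{u}) :
    IncoRankGE (expBox b (update e i (k + 1 : ℕ))) (γ * ω) := by
  refine IncoRankGE.of_forall_lt fun δ hδ => ?_
  obtain ⟨c, hc, hδ⟩ := (lt_mul_iff_of_isSuccLimit isSuccLimit_omega0).1 hδ
  obtain ⟨m, rfl⟩ := lt_omega0.1 hc
  refine ⟨_, hδ, (incoRankGE_box_mul_natCast hij (toExp_ne_zero hj)
    (by simp only [update_of_ne hij]) h m b).mono fun f hf t => ?_⟩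
  have := hf t
  rcases eq_or_ne t i with rfl | ht
  · simp only [update_self, toExp_natCast] at this ⊢
    refine ⟨this.1, this.2.trans_le ?_⟩
    push_cast
    rw [opow_add_one]
    gcongr
  · simpa only [update_of_ne ht] using this

/-- Coordinate `i₀`, of length `ω`, is only the auxiliary direction and contributes nothing to the
exponent. A finite nonzero exponent makes the total a successor; if there is none, an infinite one
makes it a limit. -/
theorem incoRankGE_expBox {i₀ : Fin n} (e : Fin n → ℕ∞) (he : e i₀ = 0)
    (b : Fin n → Ordinal.{u}) :
    IncoRankGE (expBox b (update e i₀ 1)) (ω ^ totalExp.{u} e) := by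
  induction h : totalExp.{u} e using WellFoundedLT.induction generalizing e b with
  | ind E ih =>
    subst h
    have ne_of : ∀ {i}, e i ≠ 0 → i ≠ i₀ := by
      rintro i hi rfl
      exact hi he
    by_cases hfin : ∃ i, e i ≠ 0 ∧ e i ≠ ⊤
    · obtain ⟨i, hi0, hit⟩ := hfin
      have hi := ne_of hi0
      obtain ⟨a, ha⟩ := ENat.ne_top_iff_exists.1 hit
      obtain ⟨k, rfl⟩ := Nat.exists_eq_succ_of_ne_zero
        (by rintro rfl; exact hi0 (by simpa using ha.symm) : a ≠ 0)
      have hk : (k : ℕ∞) < e i := by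
        rw [← ha]
        exact_mod_cast Nat.lt_succ_self k
      obtain ⟨c, s, -, H⟩ := exists_totalExp_update.{u} e i
      have heq : totalExp.{u} e = totalExp (update e i k) + 1 := by
        have := H (e i)
        rw [update_eq_self, ← ha] at this
        rw [this, H]
        simp only [ENat.natCast_ne_top, if_false, ENat.toNat_natCast]
        push_cast
        simp only [add_assoc]
      have step := incoRankGE_expBox_add_one (e := update e i₀ 1) (i := i) (j := i₀) hi.symm
        (by simp) (k := k) (γ := ω ^ totalExp.{u} (update e i k)) (fun b' => by
          rw [update_comm hi.symm]
          exact ih _ (totalExp_update_lt hk) _ (by rw [update_of_ne hi.symm, he]) b' rfl) b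
      rw [heq, opow_add_one]
      rwa [update_comm hi.symm, show ((k + 1 : ℕ) : ℕ∞) = e i from ha, update_eq_self] at step
    · push Not at hfin
      by_cases htop : ∃ i, e i = ⊤
      · obtain ⟨i, hi⟩ := htop
        have hne := ne_of (i := i) (by simp [hi])
        obtain ⟨c, s, hs, H⟩ := exists_totalExp_update.{u} e i
        -- All exponents are now `0` or `⊤`, whose `toNat` is zero.
        have hs0 : s = 0 := by
          have : ∑ j, (e j).toNat = 0 := Finset.sum_eq_zero fun j _ => by
            rcases eq_or_ne (e j) 0 with h | h
            · simp [h]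
            · simp [hfin j h]
          omega
        subst hs0
        have heq : totalExp.{u} e = ω * c + ω := by
          have := H (e i)
          rw [update_eq_self, hi] at this
          rw [this]
          simp [mul_add]
        refine IncoRankGE.of_forall_lt fun δ hδ => ?_
        rw [heq] at hδ
        obtain ⟨k, hk⟩ := exists_lt_opow_add_natCast hδ
        have hki : (k : ℕ∞) < e i := hi ▸ ENat.natCast_lt_top k
        have heqk : totalExp.{u} (update e i k) = ω * c + k := by
          rw [H]
          simp
        refine ⟨_, hk, ?_⟩
        rw [← heqk]
        refine (ih _ (totalExp_update_lt hki) _ (by rw [update_of_ne hne.symm, he]) b rfl).mono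
          (expBox_mono b ?_)
        rw [update_comm hne]
        exact update_le_iff.2 ⟨by rw [update_of_ne hne, hi]; exact le_top, fun _ _ => le_rfl⟩
      · have h0 : ∀ i, e i = 0 := fun i => by
          by_contra h
          exact htop ⟨i, hfin i h⟩
        have : totalExp.{u} e = 0 := by simp [totalExp, h0]
        rw [this, opow_zero]
        exact incoRankGE_one ⟨b, fun i => ⟨le_rfl, lt_add_of_pos_right _ (opow_pos _ omega0_pos)⟩⟩

theorem totalExp_top : totalExp.{u} (fun _ : Fin n => ⊤) = ω * n := by simp [totalExp]

theorem incoRankGE_expBox_top (hn : 2 ≤ n) (b : Fin n → Ordinal.{u}) :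
    IncoRankGE (expBox b fun _ => ⊤) (ω ^ (ω * (n : Ordinal.{u}))) := by
  obtain ⟨m, rfl⟩ : ∃ m, n = m + 2 := ⟨n - 2, by omega⟩
  set e : Fin (m + 2) → ℕ∞ := fun _ => ⊤ with he
  obtain ⟨c, s, hs, H⟩ := exists_totalExp_update.{u} e 0
  have hs0 : s = 0 := by simpa [he] using hs
  subst hs0
  have hc : ω * ((m + 2 : ℕ) : Ordinal.{u}) = ω * c + ω := by
    have := H ⊤
    rw [update_eq_self_iff.2 rfl, he, totalExp_top] at this
    rw [this]
    simp [mul_add]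
  have hzero : totalExp.{u} (update e 0 0) = ω * c := by
    rw [H]
    simp
  -- Coordinate `0` starts with exponent `1` as the auxiliary one, hence the lag of `k` behind `k +
  -- 1`; it then grows with coordinate `1` as auxiliary.
  have main : ∀ k : ℕ, ∀ b : Fin (m + 2) → Ordinal.{u},
      IncoRankGE (expBox b (update e 0 (k + 1 : ℕ))) (ω ^ (ω * c + k : Ordinal.{u})) := by
    intro k
    induction k with
    | zero =>
      intro b
      have := incoRankGE_expBox (i₀ := 0) (update e 0 0) (by simp) b
      simpa [hzero] using this
    | succ k ih =>
      intro b
      push_cast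
      rw [← add_assoc, opow_add_one]
      exact_mod_cast incoRankGE_expBox_add_one (e := e) (i := 0) (j := 1) (by simp)
        (by simp [he]) ih b
  refine IncoRankGE.of_forall_lt fun δ hδ => ?_
  rw [hc] at hδ
  obtain ⟨k, hk⟩ := exists_lt_opow_add_natCast hδ
  exact ⟨_, hk, (main k b).mono (expBox_mono b fun _ => le_top)⟩

end Boxes

/-! ### Transfer to powers of `ω ^ ω` -/

section Powers

/-- The coordinatewise identification of a power of an ordinal with tuples of ordinals. -/
noncomputable def toTuple {α : Ordinal.{u}} {n : ℕ} (p : OrdinalPower α n) :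
    Fin n → Ordinal.{u} := fun i => ((p i).toOrd : Ordinal.{u})

theorem toTuple_le_iff {α : Ordinal.{u}} {n : ℕ} {p q : OrdinalPower α n} :
    toTuple p ≤ toTuple q ↔ p ≤ q :=
  forall_congr' fun _ => ToType.mk.symm.le_iff_le

theorem range_toTuple (n : ℕ) :
    Set.range (toTuple (α := ω ^ ω) (n := n)) = expBox (0 : Fin n → Ordinal.{u}) fun _ => ⊤ := by
  ext f
  constructor
  · rintro ⟨p, rfl⟩ i
    refine ⟨bot_le, ?_⟩
    simp only [Pi.zero_apply, zero_add, toExp_top]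
    exact (p i).toOrd.2
  · intro hf
    refine ⟨fun i => ToType.mk ⟨f i, by simpa using (hf i).2⟩, ?_⟩
    ext i
    simp [toTuple]

theorem badRankLE_ordinalPower (n : ℕ) :
    BadRankLE (Set.univ : Set (OrdinalPower.{u} (ω ^ ω) n)) (ω ^ (ω * (n : Ordinal.{u}))) := by
  have h := badRankLE_expBox (fun _ : Fin n => ⊤) (0 : Fin n → Ordinal.{u})
  rw [totalExp_top, ← range_toTuple] at h
  exact (h.comap (g := toTuple) fun p q => toTuple_le_iff.1).mono
    fun p _ => Set.mem_range_self (f := toTuple) p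

theorem incoRankGE_ordinalPower {n : ℕ} (hn : 2 ≤ n) :
    IncoRankGE (Set.univ : Set (OrdinalPower.{u} (ω ^ ω) n)) (ω ^ (ω * (n : Ordinal.{u}))) := by
  have h := incoRankGE_expBox_top hn (0 : Fin n → Ordinal.{u})
  rw [← range_toTuple] at h
  exact (h.comap (g := toTuple) (fun p q => toTuple_le_iff.2) subset_rfl).mono
    (Set.subset_univ _)

end Powers

end WqoInvariants

theorem mainTheorem9 (n : ℕ) (hn : 2 ≤ n) :
    WqoInvariants.width
        (WqoInvariants.OrdinalPower.{u} (Ordinal.omega0 ^ Ordinal.omega0) n) =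
      Ordinal.omega0 ^ (Ordinal.omega0 * (n : Ordinal.{u})) ∧
    WqoInvariants.maxOrderType
        (WqoInvariants.OrdinalPower.{u} (Ordinal.omega0 ^ Ordinal.omega0) n) =
      Ordinal.omega0 ^ (Ordinal.omega0 * (n : Ordinal.{u})) := by
  have upper := WqoInvariants.badRankLE_ordinalPower.{u} n
  have lower := WqoInvariants.incoRankGE_ordinalPower.{u} hn
  exact ⟨le_antisymm (WqoInvariants.treeRank_le (WqoInvariants.Inco_subset_Bad _) upper)
      (WqoInvariants.le_treeRank subset_rfl lower),
    le_antisymm (WqoInvariants.treeRank_le subset_rfl upper)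
      (WqoInvariants.le_treeRank (WqoInvariants.Inco_subset_Bad _) lower)⟩
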